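/- Here "countable group" means a group of cardinality $\aleph_0$ (in particular infinite). An action of a group $G$ on a set $X$ is called amenable if there is a $G$-invariant map $\mu$ from the collection of all subsets of $X$ to $[0,1]$ such that $\mu(X)=1$ and $\mu(A\cup B)=\mu(A)+\mu(B)$ whenever $A\cap B=\varnothing$. Let $\mathcal A$ be the class of all countable groups that admit a faithful transitive amenable action. A countable group has property (F) if each of its amenable actions on a (finite or countably infinite) set has a fixed point, and it has virtually (F) if one of its finite index subgroups has property (F). Let $2\le n\le\infty$ (where $n=\infty$ stands for a countably infinite family), let $(G_i)_{1\le i\le n}$ be countable groups, and let $G=*_{i=1}^n G_i$ be their free product. Then exactly one of the following holds: either $G\in\mathcal A$, or $G$ has virtually (F). Moreover, $G$ has virtually (F) if and only if $n\neq\infty$ and there is an index $i_0$ such that $G_{i_0}$ has virtually (F) and all $G_i$ with $i\neq i_0$ have property (F). -/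

import Mathlib

/-- An invariant mean for the action of `G` on `X`: a finitely additive `G`-invariant map `m` from
the collection of all subsets of `X` to `[0,1]` with `m X = 1`. -/
structure IsInvariantMean (G : Type*) {X : Type*} [Group G] [MulAction G X]
    (m : Set X → ℝ) : Prop where
  nonneg : ∀ A : Set X, 0 ≤ m A
  le_one : ∀ A : Set X, m A ≤ 1
  union : ∀ A B : Set X, Disjoint A B → m (A ∪ B) = m A + m B
  univ : m Set.univ = 1
  smul : ∀ (g : G) (A : Set X), m ((fun x => g • x) '' A) = m A

/-- The action of `G` on `X` is amenable if it admits an invariant mean. -/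
def IsAmenableAction (G X : Type*) [Group G] [MulAction G X] : Prop :=
  ∃ m : Set X → ℝ, IsInvariantMean G m

/-- The fixed point property (F): every amenable action of `G` on a countable set has a fixed
point. (Every countable set, in whatever universe, is in bijection with one in `Type`.) -/
def HasPropertyF (G : Type*) [Group G] : Prop :=
  ∀ (X : Type) [Countable X] [MulAction G X], IsAmenableAction G X → ∃ x : X, ∀ g : G, g • x = x

/-- `G` has virtually (F) if some finite index subgroup of `G` has property (F). -/
def HasVirtuallyF (G : Type*) [Group G] : Prop :=
  ∃ H : Subgroup G, H.FiniteIndex ∧ HasPropertyF H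

/-- The class `𝒜` of the countably infinite groups that admit a faithful transitive amenable action
on a (necessarily countable) set. -/
def MemClassA (G : Type*) [Group G] : Prop :=
  Countable G ∧ Infinite G ∧
    ∃ (X : Type) (_ : Countable X) (_ : MulAction G X),
      FaithfulSMul G X ∧ MulAction.IsPretransitive G X ∧ IsAmenableAction G X

/-!
Write `π i` for the projection of `G = *ᵢ G i` onto a factor (`Monoid.CoprodI.proj`).

A group with virtual property (F) is not in `𝒜`, because a finite index subgroup with a fixed point
makes a transitive action finite (`HasVirtuallyF.not_memClassA`). So it remains to see that `G` has
virtually (F) under the condition on the factors, and that it lies in `𝒜` otherwise.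

If a group with (F) acts on a set with an invariant mean, its fixed points have mean one
(`HasPropertyF.mean_fixed_eq_one`), hence finitely many such groups have a common fixed point. If
`H` is a finite index subgroup of `G i₀` with (F), the subgroup `(π i₀)⁻¹ H` is generated by `H` and
finitely many conjugates of the other factors, so it has (F) (`hasVirtuallyF_coprodI`).

Membership in `𝒜` comes from one gluing construction (`memClassA_of_null_set`). Let `C` be a `G`-set
with an invariant mean, and let `T` be a null subset of `C` that meets every orbit and is invariant
under one factor `G a`. Take the disjoint union of the regular `G`-set and `C`, and change the
action of `G a` alone, so that each `t` in `T` is adjoined to its own regular `G a`-orbit. By the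
universal property of the free product this defines an action of `G`. It is transitive. It is faithful,
because each element of `G` still acts by left multiplication somewhere: the changes inside the
regular part take place in the kernel of `π b` for some `b ≠ a`, and `G b` is infinite. The mean of
`C` remains invariant since `T` is null.

Pairs `(C, T)` exist in the three cases in which the condition fails.
* Some factor is not virtually (F): a null set meeting every orbit exists for a suitable amenable
  action of that factor (`exists_null_set_of_not_hasVirtuallyF`). When all orbits are infinite, one
  of uncountably many almost disjoint transversals must be null.
* Two factors have proper finite index subgroups: the free product then has finite transitive
  actions of any size in which one of these factors has orbits of bounded size
  (`memClassA_of_finite_actions`).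
* There are infinitely many factors: a limit of point masses at points that each element of `G`
  eventually fixes is an invariant mean (`memClassA_of_infinite`).
-/

open Filter Topology Monoid Monoid.CoprodI

/-! ### Invariant means -/

namespace IsInvariantMean

variable {G X : Type*} [Group G] [MulAction G X] {m : Set X → ℝ}

theorem empty (hm : IsInvariantMean G m) : m ∅ = 0 := by
  have h := hm.union ∅ ∅ (Set.disjoint_empty _)
  simp only [Set.union_self] at h
  linarith

theorem mono (hm : IsInvariantMean G m) {A B : Set X} (h : A ⊆ B) : m A ≤ m B := by
  have h1 := hm.union A (B \ A) Set.disjoint_sdiff_right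
  rw [Set.union_sdiff_cancel h] at h1
  linarith [hm.nonneg (B \ A)]

theorem union_add_inter (hm : IsInvariantMean G m) (A B : Set X) :
    m (A ∪ B) + m (A ∩ B) = m A + m B := by
  have h1 := hm.union A (B \ A) Set.disjoint_sdiff_right
  have h2 := hm.union (A ∩ B) (B \ A)
    (Set.disjoint_sdiff_right.mono_left Set.inter_subset_left)
  rw [Set.union_sdiff_self] at h1
  rw [Set.inter_comm, Set.inter_union_sdiff, Set.inter_comm] at h2
  linarith

theorem nonempty_of_eq_one (hm : IsInvariantMean G m) {A : Set X} (hA : m A = 1) :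
    A.Nonempty := by
  rw [Set.nonempty_iff_ne_empty]
  rintro rfl
  exact zero_ne_one (hm.empty.symm.trans hA)

theorem compl (hm : IsInvariantMean G m) (A : Set X) : m Aᶜ = 1 - m A := by
  have h1 := hm.union A Aᶜ disjoint_compl_right
  rw [Set.union_compl_self, hm.univ] at h1
  linarith

theorem union_null (hm : IsInvariantMean G m) {A B : Set X} (hA : m A = 0) (hB : m B = 0) :
    m (A ∪ B) = 0 := by
  linarith [hm.union_add_inter A B, hm.nonneg (A ∩ B), hm.nonneg (A ∪ B)]

theorem mono_null (hm : IsInvariantMean G m) {A B : Set X} (h : A ⊆ B) (hB : m B = 0) :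
    m A = 0 :=
  le_antisymm (hB ▸ hm.mono h) (hm.nonneg A)

theorem inter_eq_one (hm : IsInvariantMean G m) {A B : Set X} (hA : m A = 1) (hB : m B = 1) :
    m (A ∩ B) = 1 := by
  linarith [hm.union_add_inter A B, hm.le_one (A ∩ B), hm.le_one (A ∪ B)]

theorem iInter_eq_one (hm : IsInvariantMean G m) {κ : Type*} [Finite κ] {A : κ → Set X}
    (hA : ∀ k, m (A k) = 1) : m (⋂ k, A k) = 1 := by
  classical
  have key : ∀ s : Finset κ, m (⋂ k ∈ s, A k) = 1 := by
    intro s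
    induction s using Finset.induction_on with
    | empty => simpa using hm.univ
    | insert k s _ ih =>
      rw [Finset.set_biInter_insert]
      exact hm.inter_eq_one (hA k) ih
  have := Fintype.ofFinite κ
  simpa using key Finset.univ

theorem congr_off_null (hm : IsInvariantMean G m) {A B N : Set X} (hN : m N = 0)
    (h : ∀ x ∉ N, x ∈ A ↔ x ∈ B) : m A = m B := by
  have key : ∀ C : Set X, m (C \ N) = m C := by
    intro C
    have h1 := hm.union (C ∩ N) (C \ N)
      (Set.disjoint_sdiff_right.mono_left Set.inter_subset_right)
    rw [Set.inter_union_sdiff, hm.mono_null Set.inter_subset_right hN] at h1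
    linarith
  rw [← key A, ← key B]
  congr 1
  ext x
  by_cases hx : x ∈ N <;> simp [hx, h]

theorem comp_smul (hm : IsInvariantMean G m) (g : G) (A : Set X) :
    m ((fun x => g • x) ⁻¹' A) = m A := by
  rw [← hm.smul g ((fun x => g • x) ⁻¹' A),
    Set.image_preimage_eq _ (MulAction.surjective g)]

theorem of_preimage (nonneg : ∀ A : Set X, 0 ≤ m A) (le_one : ∀ A : Set X, m A ≤ 1)
    (union : ∀ A B : Set X, Disjoint A B → m (A ∪ B) = m A + m B) (univ : m Set.univ = 1)
    (smul : ∀ (g : G) (A : Set X), m ((fun x => g • x) ⁻¹' A) = m A) :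
    IsInvariantMean G m where
  nonneg := nonneg
  le_one := le_one
  union := union
  univ := univ
  smul g A := by
    rw [← smul g, Set.preimage_image_eq _ (MulAction.injective g)]

/-- The push-forward of a mean under a map `f` is an invariant mean for the action of another group
`G'` as soon as it is `G'`-invariant; `f` itself need not be equivariant. -/
theorem map {G' Y : Type*} [Group G'] [MulAction G' Y] (hm : IsInvariantMean G m) (f : X → Y)
    (hf : ∀ (g' : G') (A : Set Y), m (f ⁻¹' ((fun y => g' • y) ⁻¹' A)) = m (f ⁻¹' A)) :
    IsInvariantMean G' (fun A : Set Y => m (f ⁻¹' A)) :=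
  of_preimage (fun _ => hm.nonneg _) (fun _ => hm.le_one _)
    (fun A B h => by
      simp only [Set.preimage_union]
      exact hm.union _ _ (h.preimage f))
    (by simpa using hm.univ) hf

theorem comap {L : Type*} [Group L] [MulAction L X] (hm : IsInvariantMean G m) (φ : L → G)
    (hφ : ∀ (l : L) (x : X), l • x = φ l • x) : IsInvariantMean L m where
  nonneg := hm.nonneg
  le_one := hm.le_one
  union := hm.union
  univ := hm.univ
  smul l A := by simpa only [hφ] using hm.smul (φ l) A

end IsInvariantMean

/-- Means that are asymptotically invariant accumulate at an invariant mean. -/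
theorem exists_isInvariantMean_of_tendsto {G X : Type*} [Group G] [MulAction G X]
    (m : ℕ → Set X → ℝ) (nonneg : ∀ k A, 0 ≤ m k A) (le_one : ∀ k A, m k A ≤ 1)
    (union : ∀ k A B, Disjoint A B → m k (A ∪ B) = m k A + m k B) (univ : ∀ k, m k Set.univ = 1)
    (smul : ∀ (g : G) (A : Set X),
      Tendsto (fun k => m k ((fun x => g • x) '' A) - m k A) atTop (𝓝 0)) :
    ∃ μ : Set X → ℝ, IsInvariantMean G μ ∧
      ∀ A, Tendsto (fun k => m k A) atTop (𝓝 0) → μ A = 0 := by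
  have hlim : ∀ A, ∃ L ∈ Set.Icc (0 : ℝ) 1,
      Tendsto (fun k => m k A) (hyperfilter ℕ : Filter ℕ) (𝓝 L) := by
    intro A
    obtain ⟨L, hL, h⟩ := (isCompact_Icc (a := (0 : ℝ)) (b := 1)).ultrafilter_le_nhds
      ((hyperfilter ℕ).map fun k : ℕ => m k A) (by
        rw [le_principal_iff, Ultrafilter.coe_map]
        exact Filter.mem_map.2 (Filter.univ_mem' fun k => ⟨nonneg k A, le_one k A⟩))
    exact ⟨L, hL, h⟩
  have hle : (hyperfilter ℕ : Filter ℕ) ≤ atTop := by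
    rw [← Nat.cofinite_eq_atTop]; exact hyperfilter_le_cofinite
  choose μ hμ hT using hlim
  refine ⟨μ, ⟨fun A => (hμ A).1, fun A => (hμ A).2, ?_, ?_, ?_⟩, ?_⟩
  · intro A B h
    refine tendsto_nhds_unique (hT (A ∪ B)) ?_
    simpa only [union _ A B h] using (hT A).add (hT B)
  · refine tendsto_nhds_unique (hT Set.univ) ?_
    simp only [univ]
    exact tendsto_const_nhds
  · intro g A
    have h := tendsto_nhds_unique ((hT _).sub (hT A)) ((smul g A).mono_left hle)
    linarith
  · intro A h
    exact tendsto_nhds_unique (hT A) (h.mono_left hle)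

/-- The limit of the uniform means on finite `G`-sets `C k` is an invariant mean on their disjoint
union, null on a subset that has vanishing proportion in `C k`. -/
theorem exists_isInvariantMean_sigma {G : Type*} [Group G] (C : ℕ → Type*)
    [∀ k, Finite (C k)] [∀ k, Nonempty (C k)] [∀ k, MulAction G (C k)] (T : ∀ k, Set (C k))
    (hT : ∀ k, (k + 1) * (T k).ncard ≤ Nat.card (C k)) :
    ∃ μ : Set (Σ k, C k) → ℝ, IsInvariantMean G μ ∧ μ {x | x.2 ∈ T x.1} = 0 := by
  have hpos : ∀ k, (0 : ℝ) < Nat.card (C k) := fun k => by exact_mod_cast Nat.card_pos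
  obtain ⟨μ, hμ, h0⟩ := exists_isInvariantMean_of_tendsto (G := G)
    (fun k (A : Set (Σ k, C k)) => ((Sigma.mk k ⁻¹' A).ncard : ℝ) / Nat.card (C k))
    (fun k A => by positivity)
    (fun k A => by
      rw [div_le_one (hpos k)]
      exact_mod_cast Set.ncard_le_card _)
    (fun k A B h => by
      rw [Set.preimage_union, Set.ncard_union_eq (h.preimage _), Nat.cast_add, add_div])
    (fun k => by
      rw [Set.preimage_univ, Set.ncard_univ, div_self (hpos k).ne'])
    (fun g A => by
      refine tendsto_const_nhds.congr fun k => ?_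
      have : Sigma.mk k ⁻¹' ((fun x => g • x) '' A) = (fun x => g • x) '' (Sigma.mk k ⁻¹' A) := by
        ext x
        constructor
        · rintro ⟨⟨k', y⟩, hy, h⟩
          obtain ⟨rfl, h⟩ := Sigma.mk.inj_iff.1 h
          exact ⟨y, hy, eq_of_heq h⟩
        · rintro ⟨y, hy, rfl⟩
          exact ⟨⟨k, y⟩, hy, rfl⟩
      rw [this, Set.ncard_image_of_injective _ (MulAction.injective g), sub_self])
  refine ⟨μ, hμ, h0 _ ?_⟩
  refine squeeze_zero (fun k => by positivity) (fun k => ?_) tendsto_one_div_add_atTop_nhds_zero_nat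
  rw [div_le_div_iff₀ (hpos k) (by positivity), one_mul, mul_comm]
  exact_mod_cast hT k

/-! ### Free products -/

/-- The class `𝒜` is defined through sets in `Type`; a faithful transitive amenable action on a
countable set `X` in any universe, given as a permutation representation, suffices. The mean is
invariant under the group of permutations by which `G` acts. -/
theorem memClassA_of_hom {G X : Type*} [Group G] [Countable G] [Infinite G] [Countable X]
    (P : G →* Equiv.Perm X) (hP : Function.Injective P) (htrans : ∀ x y, ∃ g, P g x = y)
    {m : Set X → ℝ} (hm : IsInvariantMean P.range m) : MemClassA G := by
  obtain ⟨f, hf⟩ := Countable.exists_injective_nat X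
  let e : Set.range f ≃ X := (Equiv.ofInjective f hf).symm
  let : MulAction G X := MulAction.compHom X P
  let : MulAction G (Set.range f) := e.mulAction G
  have he : ∀ (g : G) (y : Set.range f), e (g • y) = P g (e y) := fun g y =>
    e.apply_symm_apply _
  refine ⟨inferInstance, inferInstance, Set.range f, inferInstance, inferInstance, ⟨?_⟩, ⟨?_⟩,
    _, hm.map e.symm fun g A => ?_⟩
  · intro g h hgh
    refine hP (Equiv.ext fun x => ?_)
    have := congrArg e (hgh (e.symm x))
    simpa [he] using this
  · intro x y
    obtain ⟨g, hg⟩ := htrans (e x) (e y)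
    exact ⟨g, e.injective ((he _ _).trans hg)⟩
  · rw [← hm.comp_smul ⟨P g, g, rfl⟩ (e.symm ⁻¹' A)]
    congr 1
    ext x
    simp only [Set.mem_preimage]
    rw [← e.symm_apply_apply (g • e.symm x), he, e.apply_symm_apply]
    rfl

/-- Regluing an action: given an invariant subset of a `Γ`-set `X`, parametrised by `T × Γ`, the
action on it can be replaced by left multiplication on the second factor. -/
theorem exists_reglued_action {Γ X T : Type*} [Group Γ] [MulAction Γ X] (J : T × Γ → X)
    (hJ : Function.Injective J) (hinv : ∀ (g : Γ) (x : X), x ∈ Set.range J → g • x ∈ Set.range J) :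
    ∃ ρ : Γ →* Equiv.Perm X, (∀ g t k, ρ g (J (t, k)) = J (t, g * k)) ∧
      ∀ g, ∀ x ∉ Set.range J, ρ g x = g • x := by
  classical
  let s : Γ → X → X := fun g x =>
    if h : x ∈ Set.range J then J (h.choose.1, g * h.choose.2) else g • x
  have hs1 : ∀ g t k, s g (J (t, k)) = J (t, g * k) := by
    intro g t k
    have h : J (t, k) ∈ Set.range J := ⟨_, rfl⟩
    have := hJ h.choose_spec
    simp only [s, dif_pos h, this]
  have hs2 : ∀ g, ∀ x ∉ Set.range J, s g x = g • x := fun g x h => dif_neg h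
  have hinv' : ∀ (g : Γ) (x : X), x ∉ Set.range J → g • x ∉ Set.range J := by
    intro g x hx h
    have := hinv g⁻¹ _ h
    rw [inv_smul_smul] at this
    exact hx this
  let act : MulAction Γ X :=
    { smul := s
      one_smul := fun x => by
        change s 1 x = x
        by_cases h : x ∈ Set.range J
        · obtain ⟨⟨t, k⟩, rfl⟩ := h
          rw [hs1, one_mul]
        · rw [hs2 _ _ h, one_smul]
      mul_smul := fun g g' x => by
        change s (g * g') x = s g (s g' x)
        by_cases h : x ∈ Set.range J
        · obtain ⟨⟨t, k⟩, rfl⟩ := h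
          rw [hs1, hs1, hs1, mul_assoc]
        · rw [hs2 _ _ h, hs2 _ _ h, hs2 _ _ (hinv' _ _ h), mul_smul] }
  exact ⟨@MulAction.toPermHom Γ X _ act, hs1, hs2⟩

namespace Monoid.CoprodI

variable {ι : Type*} {G : ι → Type*} [∀ i, Group (G i)]

instance [Countable ι] [∀ i, Countable (G i)] : Countable (CoprodI G) :=
  haveI : Countable (FreeMonoid (Σ i, G i)) :=
    inferInstanceAs (Countable (List (Σ i, G i)))
  Function.Surjective.countable (f := Con.mk' (conGen (CoprodI.Rel G))) Con.mk'_surjective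

theorem infinite_of_factor (i : ι) [Infinite (G i)] : Infinite (CoprodI G) :=
  Infinite.of_injective _ (of_injective i)

open Classical in
/-- The projection of a free product onto one of its factors, killing all other factors. -/
noncomputable def proj (i : ι) : CoprodI G →* G i :=
  lift (Pi.mulSingle i (MonoidHom.id (G i)))

@[simp]
theorem proj_of_self (i : ι) (g : G i) : proj i (of g) = g := by
  simp [proj]

theorem proj_of_ne {i j : ι} (h : j ≠ i) (g : G j) : proj i (of g) = 1 := by
  classical simp [proj, Pi.mulSingle_eq_of_ne h]

theorem eq_one_of_commute {a b : ι} (hab : a ≠ b) {u : G a} {v : G b} (hv : v ≠ 1)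
    (h : of u * of v = (of v * of u : CoprodI G)) : u = 1 := by
  classical
  by_contra hu
  let w₁ : Word G := ⟨[⟨a, u⟩, ⟨b, v⟩], by simp [hu, hv], by simp [hab]⟩
  let w₂ : Word G := ⟨[⟨b, v⟩, ⟨a, u⟩], by simp [hu, hv], by simp [hab.symm]⟩
  have hw : w₁ = w₂ := Word.equiv.symm.injective (by
    change w₁.prod = w₂.prod
    simpa [Word.prod, w₁, w₂] using h)
  have := congrArg Word.toList hw
  simp only [w₁, w₂, List.cons.injEq, Sigma.mk.injEq] at this
  exact hab this.1.1

end Monoid.CoprodI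


/-- A free product with an action on `C` that is amenable through a mean for which some subset `T`
is null belongs to `𝒜`, provided that `T` is invariant under one factor `G a` and meets every orbit.
The points of `T` are glued to pairwise distinct `G a`-orbits of the regular action, so that `C`
becomes part of a single orbit of a faithful action, for which `C` has mean one. -/
theorem memClassA_of_null_set {ι : Type*} [Countable ι] [Nontrivial ι] {G : ι → Type*}
    [∀ i, Group (G i)] [∀ i, Countable (G i)] [∀ i, Infinite (G i)]
    {C : Type*} [Countable C] [MulAction (CoprodI G) C] {m : Set C → ℝ}
    (hm : IsInvariantMean (CoprodI G) m) (a : ι) (T : Set C) (hT : m T = 0)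
    (hTinv : ∀ (g : G a), ∀ t ∈ T, (of g : CoprodI G) • t ∈ T)
    (hTmeet : ∀ c : C, ∃ w : CoprodI G, w • c ∈ T) : MemClassA (CoprodI G) := by
  classical
  have : Infinite (CoprodI G) := infinite_of_factor a
  obtain ⟨b, hba⟩ := exists_ne a
  obtain ⟨b₀, hb₀⟩ := exists_ne (1 : G b)
  obtain ⟨e⟩ : Nonempty (Option (G a) ≃ G a) := nonempty_equiv_of_countable
  obtain ⟨θ, hθ⟩ : ∃ θ : T → G a, Function.Injective θ := by
    obtain ⟨f, hf⟩ := Countable.exists_injective_nat T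
    exact ⟨_, (Infinite.natEmbedding (G a)).injective.comp hf⟩
  -- The points `o t` lie in distinct `G a`-orbits, all of them inside the kernel of `proj b`.
  let o : T → CoprodI G := fun t => of b₀ * of (θ t) * (of b₀)⁻¹
  have hob : ∀ t, proj b (o t) = 1 := fun t => by simp [o, proj_of_ne hba.symm]
  have hoa : ∀ t, proj a (o t) = θ t := fun t => by simp [o, proj_of_ne hba]
  have ho : ∀ t t' (g g' : G a), of g * o t = of g' * o t' → t = t' ∧ g = g' := by
    intro t t' g g' h
    have h1 : g * θ t = g' * θ t' := by
      simpa [hoa] using congrArg (proj a) h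
    have h2 : of (g'⁻¹ * g) * of b₀ = (of b₀ * of (θ t' * (θ t)⁻¹) : CoprodI G) := by
      simp only [map_mul, map_inv]
      calc (of g')⁻¹ * of g * of b₀
          = (of g')⁻¹ * (of g * o t) * of b₀ * (of (θ t))⁻¹ := by simp only [o]; group
        _ = (of g')⁻¹ * (of g' * o t') * of b₀ * (of (θ t))⁻¹ := by rw [h]
        _ = of b₀ * (of (θ t') * (of (θ t))⁻¹) := by simp only [o]; group
    have h3 : g'⁻¹ * g = θ t' * (θ t)⁻¹ := by
      simpa [proj_of_ne hba] using congrArg (proj a) h2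
    rw [← h3] at h2
    have h4 := eq_one_of_commute hba.symm hb₀ h2
    have h5 : g = g' := (inv_mul_eq_one.1 h4).symm
    subst h5
    exact ⟨hθ (mul_left_cancel h1), rfl⟩
  -- `J` parametrises the new `G a`-orbits: the orbit of `o t` with the extra point `t` adjoined. As
  -- `G a` is infinite, each of them is again in bijection with `G a`.
  let j : T × Option (G a) → CoprodI G ⊕ C := fun p =>
    p.2.elim (Sum.inr p.1) fun g => Sum.inl (of g * o p.1)
  let J : T × G a → CoprodI G ⊕ C := fun p => j (p.1, e.symm p.2)
  have hJj : ∀ t k, j (t, k) = J (t, e k) := fun t k => by simp [J]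
  have hj : Function.Injective j := by
    rintro ⟨t, _ | g⟩ ⟨t', _ | g'⟩ h
    · have : (t : C) = t' := Sum.inr_injective h
      rw [Subtype.ext this]
    · cases h
    · cases h
    · obtain ⟨rfl, rfl⟩ := ho _ _ _ _ (Sum.inl_injective h)
      rfl
  have hJ : Function.Injective J := by
    rintro ⟨t, k⟩ ⟨t', k'⟩ h
    have := hj h
    simp only [Prod.mk.injEq, EmbeddingLike.apply_eq_iff_eq] at this
    rw [this.1, this.2]
  have hrange : ∀ x, x ∈ Set.range J ↔ ∃ t k, j (t, k) = x := by
    intro x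
    constructor
    · rintro ⟨⟨t, k⟩, rfl⟩
      exact ⟨t, e.symm k, rfl⟩
    · rintro ⟨t, k, rfl⟩
      exact ⟨_, (hJj t k).symm⟩
  have hinl : ∀ x : CoprodI G, Sum.inl x ∈ Set.range J → proj b x = 1 := by
    intro x hx
    obtain ⟨t, _ | k, h⟩ := (hrange _).1 hx
    · cases h
    · rw [← Sum.inl_injective h]
      simp [hob, proj_of_ne hba.symm]
  have hinr : ∀ c : C, Sum.inr c ∈ Set.range J ↔ c ∈ T := by
    intro c
    rw [hrange]
    constructor
    · rintro ⟨t, _ | k, h⟩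
      · rw [← Sum.inr_injective h]
        exact t.2
      · cases h
    · exact fun h => ⟨⟨c, h⟩, none, rfl⟩
  let actA : MulAction (G a) (CoprodI G ⊕ C) := MulAction.compHom _ (of (i := a) (M := G))
  have hactA : ∀ (g : G a) (x : CoprodI G ⊕ C), g • x = (of g : CoprodI G) • x := fun _ _ => rfl
  obtain ⟨ρ, hρ1, hρ2⟩ := exists_reglued_action J hJ (by
    intro g x hx
    obtain ⟨t, _ | k, rfl⟩ := (hrange _).1 hx
    · exact (hinr _).2 (hTinv g _ t.2)
    · refine (hrange _).2 ⟨t, some (g * k), ?_⟩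
      simp [j, hactA, mul_assoc])
  let P : CoprodI G →* Equiv.Perm (CoprodI G ⊕ C) :=
    lift (Function.update (fun i => (MulAction.toPermHom (CoprodI G) (CoprodI G ⊕ C)).comp
      (of (i := i))) a ρ)
  have hPa : ∀ (g : G a) x, P (of g) x = ρ g x := fun g x => by simp [P]
  have hPne : ∀ (i : ι), i ≠ a → ∀ (g : G i) x, P (of g) x = (of g : CoprodI G) • x :=
    fun i hi g x => by simp [P, Function.update_of_ne hi]
  clear_value P
  have hPT : ∀ (i : ι) (g : G i), ∀ c ∉ T,
      P (of g) (Sum.inr c) = Sum.inr ((of g : CoprodI G) • c) := by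
    intro i g c hc
    by_cases hi : i = a
    · subst hi
      rw [hPa, hρ2 _ _ (fun h => hc ((hinr c).1 h))]
      rfl
    · exact hPne i hi g _
  -- Off finitely many cosets of the kernel of `proj b`, a given element still acts by left
  -- multiplication. As `G b` is infinite, this makes the new action faithful.
  have hreg : ∀ w : CoprodI G, ∃ F : Finset (G b), ∀ x, proj b x ∉ F →
      P w (Sum.inl x) = Sum.inl (w * x) := by
    intro w
    induction w using CoprodI.induction_on with
    | one => exact ⟨∅, by simp⟩
    | of i g =>
      by_cases hi : i = a
      · subst hi
        refine ⟨{1}, fun x hx => ?_⟩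
        rw [hPa, hρ2 _ _ (fun h => hx (by simpa using hinl x h))]
        rfl
      · exact ⟨∅, fun x _ => hPne i hi g _⟩
    | mul w₁ w₂ h₁ h₂ =>
      obtain ⟨F₁, h₁⟩ := h₁
      obtain ⟨F₂, h₂⟩ := h₂
      refine ⟨F₂ ∪ F₁.image fun z => (proj b w₂)⁻¹ * z, fun x hx => ?_⟩
      simp only [Finset.mem_union, Finset.mem_image, not_or, not_exists, not_and] at hx
      rw [map_mul, Equiv.Perm.mul_apply, h₂ x hx.1, h₁, mul_assoc]
      intro h
      exact hx.2 _ h (by simp)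
  have hPinj : Function.Injective P := by
    rw [injective_iff_map_eq_one]
    intro w hw
    obtain ⟨F, hF⟩ := hreg w
    obtain ⟨z, hz⟩ := Infinite.exists_notMem_finset F
    have h := hF (of z) (by simpa using hz)
    rw [hw] at h
    simpa using Sum.inl_injective h
  -- All points lie in the orbit of `1`: new `G a`-orbits contain the old ones inside the regular
  -- part, and every orbit of `C` meets `T`.
  have hinlorb : ∀ x, ∃ w, P w (Sum.inl 1) = Sum.inl x := by
    intro x
    induction x using CoprodI.induction_left with
    | one => exact ⟨1, by simp⟩
    | @mul i g x ih =>
      obtain ⟨w, hw⟩ := ih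
      suffices ∃ v, P v (Sum.inl x) = Sum.inl (of g * x) by
        obtain ⟨v, hv⟩ := this
        exact ⟨v * w, by rw [map_mul, Equiv.Perm.mul_apply, hw, hv]⟩
      by_cases hi : i = a
      · subst hi
        by_cases hx : Sum.inl x ∈ Set.range J
        · obtain ⟨t, _ | k, h⟩ := (hrange _).1 hx
          · cases h
          · have h' : Sum.inl (of g * x) = j (t, some (g * k)) := by
              rw [← Sum.inl_injective h]
              simp [j, mul_assoc]
            rw [h', ← h, hJj, hJj]
            exact ⟨of (e (some (g * k)) * (e (some k))⁻¹), by
              rw [hPa, hρ1, inv_mul_cancel_right]⟩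
        · exact ⟨of g, by rw [hPa, hρ2 _ _ hx]; rfl⟩
      · exact ⟨of g, hPne i hi g _⟩
  have hTorb : ∀ t ∈ T, ∃ w, P w (Sum.inl 1) = Sum.inr t := by
    intro t ht
    obtain ⟨w, hw⟩ := hinlorb (of 1 * o ⟨t, ht⟩)
    refine ⟨of (e none * (e (some 1))⁻¹) * w, ?_⟩
    have h1 : Sum.inl (of 1 * o ⟨t, ht⟩) = j (⟨t, ht⟩, some 1) := rfl
    rw [map_mul, Equiv.Perm.mul_apply, hw, h1, hJj, hPa, hρ1, inv_mul_cancel_right, ← hJj]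
    rfl
  have hCorb : ∀ (v : CoprodI G) (c : C), (∃ w, P w (Sum.inl 1) = Sum.inr c) →
      ∃ w, P w (Sum.inl 1) = Sum.inr (v • c) := by
    intro v c hc
    induction v using CoprodI.induction_left with
    | one => simpa using hc
    | @mul i g v ih =>
      obtain ⟨w, hw⟩ := ih
      rw [mul_smul]
      by_cases h : (of g : CoprodI G) • v • c ∈ T
      · exact hTorb _ h
      · refine ⟨of g * w, ?_⟩
        rw [map_mul, Equiv.Perm.mul_apply, hw]
        by_cases hi : i = a
        · subst hi
          exact hPT _ g _ fun h' => h (hTinv g _ h')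
        · exact hPne i hi g _
  have horb : ∀ x, ∃ w, P w (Sum.inl 1) = x := by
    rintro (x | c)
    · exact hinlorb x
    · obtain ⟨v, hv⟩ := hTmeet c
      simpa using hCorb v⁻¹ _ (hTorb _ hv)
  -- Off `T`, the action on `C` is the original one.
  have hinv : ∀ (w : CoprodI G) (A : Set (CoprodI G ⊕ C)),
      m (Sum.inr ⁻¹' (P w ⁻¹' A)) = m (Sum.inr ⁻¹' A) := by
    intro w
    induction w using CoprodI.induction_left with
    | one => simp
    | @mul i g w ih =>
      intro A
      rw [← hm.comp_smul (of g) (Sum.inr ⁻¹' A), map_mul, Equiv.Perm.coe_mul, Set.preimage_comp, ih]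
      refine hm.congr_off_null hT fun c hc => ?_
      simp only [Set.mem_preimage]
      rw [hPT _ _ _ hc]
  refine memClassA_of_hom P hPinj (fun x y => ?_)
    (hm.map (G' := P.range) Sum.inr fun ⟨_, w, hw⟩ A => ?_)
  · obtain ⟨v, hv⟩ := horb x
    obtain ⟨w, hw⟩ := horb y
    exact ⟨w * v⁻¹, by
      rw [← hv, ← Equiv.Perm.mul_apply, ← map_mul, inv_mul_cancel_right, hw]⟩
  · subst hw
    exact hinv w A

/-! ### Groups without virtual property (F) -/

/-- If all orbits are infinite, some transversal of the orbits is null: there are uncountably many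
almost disjoint transversals, and finite sets are null. -/
theorem IsInvariantMean.exists_null_transversal {G X : Type*} [Group G] [Countable X]
    [MulAction G X] {m : Set X → ℝ} (hm : IsInvariantMean G m)
    (hinf : ∀ x : X, (MulAction.orbit G x).Infinite) :
    ∃ T : Set X, m T = 0 ∧ ∀ x, ∃ g : G, g • x ∈ T := by
  -- All points of an orbit have the same mean, which vanishes if the orbit is infinite.
  have hpt : ∀ x, m {x} = 0 := by
    intro x
    by_contra hx
    have hpos : 0 < m {x} := lt_of_le_of_ne (hm.nonneg _) (Ne.symm hx)
    obtain ⟨n, hn⟩ := exists_nat_gt (1 / m {x})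
    rw [div_lt_iff₀ hpos] at hn
    obtain ⟨s, hs, hcard⟩ := (hinf x).exists_subset_card_eq n
    have key : ∀ t : Finset X, (t : Set X) ⊆ MulAction.orbit G x → m t = t.card * m {x} := by
      classical
      intro t
      induction t using Finset.induction_on with
      | empty => simp [hm.empty]
      | insert y t hy ih =>
        intro h
        rw [Finset.coe_insert, Set.insert_subset_iff] at h
        obtain ⟨g, rfl⟩ := h.1
        have hg : m {g • x} = m {x} := by
          rw [← hm.smul g {x}, Set.image_singleton]
        rw [Finset.coe_insert, Set.insert_eq, hm.union _ _ (by simpa using hy), ih h.2,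
          Finset.card_insert_of_notMem hy]
        push_cast
        rw [← hg]
        linarith
    have := key s hs
    rw [hcard] at this
    linarith [hm.le_one s]
  have hfin : ∀ s : Set X, s.Finite → m s = 0 := by
    intro s hs
    induction s, hs using Set.Finite.induction_on with
    | empty => exact hm.empty
    | insert _ _ ih => exact hm.union_null (hpt _) ih
  let Ω := MulAction.orbitRel.Quotient G X
  obtain ⟨ν, hν⟩ := Countable.exists_injective_nat Ω
  have hrep : ∀ ω : Ω, ∃ x : X, (Quotient.mk'' x : Ω) = ω := Quotient.mk''_surjective
  choose r hr using hrep
  let e : ∀ ω : Ω, ℕ ↪ MulAction.orbit G (r ω) := fun ω =>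
    haveI := (hinf (r ω)).to_subtype
    Infinite.natEmbedding _
  have he : ∀ ω n, (Quotient.mk'' (e ω n : X) : Ω) = ω := fun ω n => by
    rw [← hr ω]
    refine Quotient.sound' ?_
    rw [hr ω]
    exact (e ω n).2
  -- On the orbit `ω`, the transversal `T z` picks the point coded by the first `ν ω` bits of `z`.
  let code : (ℕ → Bool) → ℕ → ℕ := fun z n => Encodable.encode ((List.range n).map z)
  let T : (ℕ → Bool) → Set X := fun z => Set.range fun ω : Ω => (e ω (code z (ν ω)) : X)
  have hT : ∀ z z', z ≠ z' → m (T z ∩ T z') = 0 := by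
    intro z z' hz
    obtain ⟨k, hk⟩ := Function.ne_iff.1 hz
    apply hfin
    have hΩ : {ω : Ω | ν ω ≤ k}.Finite :=
      (Set.finite_Iic k).preimage hν.injOn
    refine (hΩ.image fun ω => (e ω (code z (ν ω)) : X)).subset ?_
    rintro x ⟨⟨ω, rfl⟩, ⟨ω', h⟩⟩
    refine ⟨ω, ?_, rfl⟩
    simp only at h
    have hω : ω' = ω := by rw [← he ω', h, he]
    subst hω
    have hc := (e ω').injective (Subtype.ext h)
    have hl := Encodable.encode_injective hc
    rw [List.map_inj_left] at hl
    by_contra hlt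
    exact hk (hl k (List.mem_range.2 (not_le.1 hlt))).symm
  have hbits : ¬ Countable (ℕ → Bool) := by
    rw [← Cardinal.mk_le_aleph0_iff]
    simpa using Cardinal.aleph0_lt_continuum
  -- The means of almost disjoint sets are summable, so only countably many of them are nonzero.
  obtain ⟨z, hz⟩ : ∃ z, m (T z) = 0 := by
    by_contra! hne
    have hsum : Summable fun z => m (T z) := by
      refine summable_of_sum_le (c := 1) (fun z => hm.nonneg _) fun s => ?_
      have key : ∑ z ∈ s, m (T z) = m (⋃ z ∈ s, T z) := by
        classical
        induction s using Finset.induction_on with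
        | empty => simp [hm.empty]
        | insert z s hzs ih =>
          rw [Finset.sum_insert hzs, Finset.set_biUnion_insert, ih, ← hm.union_add_inter,
            Set.inter_iUnion₂]
          have : m (⋃ z' ∈ s, T z ∩ T z') = 0 := by
            clear ih
            induction s using Finset.induction_on with
            | empty => simp [hm.empty]
            | insert z' s _ ih =>
              rw [Finset.mem_insert, not_or] at hzs
              rw [Finset.set_biUnion_insert]
              exact hm.union_null (hT _ _ hzs.1) (ih hzs.2)
          rw [this, add_zero]
      rw [key]
      exact hm.le_one _
    have hc := hsum.countable_support
    have : Function.support (fun z => m (T z)) = Set.univ :=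
      Set.eq_univ_of_forall fun z => hne z
    rw [this, Set.countable_univ_iff] at hc
    exact hbits hc
  refine ⟨T z, hz, fun x => ?_⟩
  have h : (Quotient.mk'' (e (Quotient.mk'' x) (code z (ν (Quotient.mk'' x))) : X) : Ω)
      = Quotient.mk'' x := he _ _
  obtain ⟨g, hg⟩ := Quotient.exact' h
  exact ⟨g, ⟨Quotient.mk'' x, hg.symm⟩⟩

/-- A set null for an `H`-invariant mean and meeting every `H`-orbit yields such a set for the
induced action of `L` on `(L ⧸ H) × X`, if `H` has finite index. -/
theorem exists_induced_null_set {L : Type*} [Group L] (H : Subgroup L) [H.FiniteIndex]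
    {X : Type*} [MulAction H X] {m : Set X → ℝ} (hm : IsInvariantMean H m)
    {T : Set X} (hT : m T = 0) (hmeet : ∀ x, ∃ h : H, h • x ∈ T) :
    ∃ (_ : MulAction L ((L ⧸ H) × X)) (μ : Set ((L ⧸ H) × X) → ℝ) (S : Set ((L ⧸ H) × X)),
      IsInvariantMean L μ ∧ μ S = 0 ∧ ∀ c, ∃ g : L, g • c ∈ S := by
  -- The cocycle that a choice of coset representatives defines.
  let α : L → L ⧸ H → H := fun g c => ⟨(g • c).out⁻¹ * (g * c.out), by
    rw [← QuotientGroup.eq, QuotientGroup.out_eq']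
    conv_lhs => rw [← QuotientGroup.out_eq' c]
    rfl⟩
  have hα : ∀ g c, (α g c : L) = (g • c).out⁻¹ * (g * c.out) := fun _ _ => rfl
  let act : MulAction L ((L ⧸ H) × X) :=
    { smul := fun g z => (g • z.1, α g z.1 • z.2)
      one_smul := fun ⟨c, x⟩ => by
        change (_, _) = _
        have : α 1 c = 1 := Subtype.ext (by simp [hα])
        rw [this, one_smul, one_smul]
      mul_smul := fun g g' ⟨c, x⟩ => by
        change (_, _) = (_, _)
        have : α (g * g') c = α g (g' • c) * α g' c :=
          Subtype.ext (by simp [hα, mul_assoc, mul_smul])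
        rw [this, mul_smul, mul_smul]
        rfl }
  have : Fintype (L ⧸ H) := Fintype.ofFinite _
  have hpos : (0 : ℝ) < Fintype.card (L ⧸ H) := by exact_mod_cast Fintype.card_pos
  refine ⟨act, fun A => (∑ c : L ⧸ H, m (Prod.mk c ⁻¹' A)) / Fintype.card (L ⧸ H),
    {z | z.2 ∈ T}, IsInvariantMean.of_preimage ?_ ?_ ?_ ?_ ?_, ?_, ?_⟩
  · exact fun A => div_nonneg (Finset.sum_nonneg fun c _ => hm.nonneg _) hpos.le
  · intro A
    rw [div_le_one hpos]
    calc _ ≤ ∑ c : L ⧸ H, (1 : ℝ) := Finset.sum_le_sum fun c _ => hm.le_one _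
      _ = _ := by simp
  · intro A B h
    simp only [Set.preimage_union]
    rw [← add_div, ← Finset.sum_add_distrib]
    congr 1
    exact Finset.sum_congr rfl fun c _ => hm.union _ _ (h.preimage _)
  · simp [hm.univ, hpos.ne']
  · intro g A
    congr 1
    refine Fintype.sum_equiv (MulAction.toPerm g) _ _ fun c => ?_
    exact hm.comp_smul (α g c) (Prod.mk (g • c) ⁻¹' A)
  · simp only
    rw [Finset.sum_eq_zero, zero_div]
    intro c _
    exact hT
  · rintro ⟨c, x⟩
    obtain ⟨h, hh⟩ := hmeet x
    refine ⟨c.out * h * c.out⁻¹, ?_⟩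
    have h1 : (c.out * h * c.out⁻¹ : L) • c = c := by
      have key : ∀ y : L, (y * h * y⁻¹ : L) • (y : L ⧸ H) = y := fun y => by
        rw [MulAction.Quotient.smul_mk, smul_eq_mul, inv_mul_cancel_right]
        exact QuotientGroup.mk_mul_of_mem _ h.2
      simpa only [QuotientGroup.out_eq'] using key c.out
    have h2 : α (c.out * h * c.out⁻¹) c = h := Subtype.ext (by
      rw [hα, h1]
      group)
    change α (c.out * h * c.out⁻¹) c • x ∈ T
    rwa [h2]

/-- A countable group without virtual property (F) has an amenable action with a null set meeting
every orbit. If the indices of its finite index subgroups are unbounded, the disjoint union of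
finite coset spaces of growing size is such an action. Otherwise some finite index subgroup `H` has
no proper finite index subgroup, so that an amenable action of `H` without fixed points has
infinite orbits only, and it can be induced. -/
theorem exists_null_set_of_not_hasVirtuallyF.{u} {L : Type u} [Group L] [Countable L]
    (h : ¬ HasVirtuallyF L) :
    ∃ (C : Type u) (_ : Countable C) (_ : MulAction L C) (m : Set C → ℝ) (T : Set C),
      IsInvariantMean L m ∧ m T = 0 ∧ ∀ c : C, ∃ g : L, g • c ∈ T := by
  by_cases hb : ∀ k : ℕ, ∃ H : Subgroup L, H.FiniteIndex ∧ k + 1 ≤ H.index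
  · choose H hH hk using hb
    obtain ⟨m, hm, hT⟩ := exists_isInvariantMean_sigma (G := L) (fun k => L ⧸ H k)
      (fun k => {(QuotientGroup.mk 1 : L ⧸ H k)}) (fun k => by
        rw [Set.ncard_singleton, mul_one, ← Subgroup.index_eq_card]
        exact hk k)
    refine ⟨_, inferInstance, inferInstance, m, _, hm, hT, ?_⟩
    rintro ⟨k, c⟩
    obtain ⟨g, hg⟩ := MulAction.exists_smul_eq L c (QuotientGroup.mk 1)
    exact ⟨g, hg⟩
  · -- A finite index subgroup of maximal index has no proper finite index subgroups.
    push Not at hb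
    obtain ⟨k, hk⟩ := hb
    have hbdd : BddAbove {n | ∃ H : Subgroup L, H.FiniteIndex ∧ H.index = n} :=
      ⟨k, by rintro _ ⟨H, hH, rfl⟩; exact Nat.lt_succ_iff.1 (hk H hH)⟩
    have hne : {n | ∃ H : Subgroup L, H.FiniteIndex ∧ H.index = n}.Nonempty :=
      ⟨1, ⊤, inferInstance, Subgroup.index_top⟩
    obtain ⟨H, hH, hmax⟩ := Nat.sSup_mem hne hbdd
    have hmax' : ∀ H' : Subgroup L, H'.FiniteIndex → H'.index ≤ H.index := fun H' h' =>
      hmax ▸ le_csSup hbdd ⟨H', h', rfl⟩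
    have hF : ¬ HasPropertyF H := fun hF => h ⟨H, hH, hF⟩
    simp only [HasPropertyF, not_forall] at hF
    obtain ⟨X, hX, act, ⟨m, hm⟩, hfix⟩ := hF
    obtain ⟨T, hT, hmeet⟩ := hm.exists_null_transversal (fun x => by
      by_contra hfin
      rw [Set.not_infinite] at hfin
      have hidx : (MulAction.stabilizer H x).index ≠ 0 := by
        rw [MulAction.index_stabilizer]
        exact ((Set.ncard_pos hfin).2 ⟨x, MulAction.mem_orbit_self x⟩).ne'
      have h1 := Subgroup.index_map_subtype (MulAction.stabilizer H x)
      have h2 := hmax' ((MulAction.stabilizer H x).map H.subtype)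
        ⟨by rw [h1]; exact mul_ne_zero hidx hH.index_ne_zero⟩
      rw [h1] at h2
      have h3 : (MulAction.stabilizer H x).index ≤ 1 :=
        le_of_mul_le_mul_right (by simpa using h2) (Nat.pos_of_ne_zero hH.index_ne_zero)
      have h4 : MulAction.stabilizer H x = ⊤ := Subgroup.index_eq_one.1 (by omega)
      exact hfix ⟨x, fun g => by
        rw [← MulAction.mem_stabilizer_iff, h4]; trivial⟩)
    obtain ⟨act', μ, S, hμ⟩ := exists_induced_null_set H hm hT hmeet
    exact ⟨(L ⧸ H) × X, inferInstance, act', μ, S, hμ⟩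

/-! ### Groups with virtual property (F) -/

/-- A finite index subgroup with a fixed point in a transitive action forces the set to be finite,
which a faithful action of an infinite group excludes. -/
theorem HasVirtuallyF.not_memClassA {G : Type*} [Group G] (h : HasVirtuallyF G) :
    ¬ MemClassA G := by
  rintro ⟨_, hinf, X, hX, act, hfaith, htrans, m, hm⟩
  obtain ⟨H, hH, hF⟩ := h
  obtain ⟨x, hx⟩ := hF X ⟨m, hm.comap (L := H) (fun h => h) fun _ _ => rfl⟩
  have hle : H ≤ MulAction.stabilizer G x := fun h hh => hx ⟨h, hh⟩
  have hfi := Subgroup.finiteIndex_of_le hle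
  have hidx := MulAction.index_stabilizer_of_transitive G x
  have : Nonempty X := ⟨x⟩
  have : Finite X := Nat.finite_of_card_ne_zero (hidx ▸ hfi.index_ne_zero)
  have : Finite G := Finite.of_injective _ (MulAction.toPerm_injective (α := G) (β := X))
  exact not_finite G

/-- The points fixed by a group with property (F) have mean one: otherwise their complement would
carry an amenable action without fixed points. -/
theorem HasPropertyF.mean_fixed_eq_one {L K : Type*} [Group L] [Group K] (hL : HasPropertyF L)
    {X : Type} [Countable X] [MulAction K X] {m : Set X → ℝ} (hm : IsInvariantMean K m)
    (φ : L →* K) : m {x | ∀ l, φ l • x = x} = 1 := by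
  by_contra hne
  set S : Set X := {x | ∀ l, φ l • x = x} with hS
  have hpos : 0 < m Sᶜ := by
    rw [hm.compl]
    linarith [lt_of_le_of_ne (hm.le_one S) hne]
  have hinv : ∀ (l : L) (x : X), x ∈ Sᶜ → φ l • x ∈ Sᶜ := by
    intro l x hx h
    refine hx ?_
    have h1 := h l⁻¹
    rw [map_inv, inv_smul_smul] at h1
    rw [h1]
    exact h
  let act : MulAction L (Sᶜ : Set X) :=
    { smul := fun l x => ⟨φ l • x.1, hinv l x.1 x.2⟩
      one_smul := fun x => Subtype.ext (by
        change φ 1 • x.1 = x.1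
        rw [map_one, one_smul])
      mul_smul := fun l l' x => Subtype.ext (by
        change φ (l * l') • x.1 = φ l • φ l' • x.1
        rw [map_mul, mul_smul]) }
  obtain ⟨x, hx⟩ := hL (Sᶜ : Set X) ⟨fun A => m (Subtype.val '' A) / m Sᶜ,
    { nonneg := fun A => div_nonneg (hm.nonneg _) hpos.le
      le_one := fun A => (div_le_one hpos).2 (hm.mono (by rintro _ ⟨y, _, rfl⟩; exact y.2))
      union := fun A B h => by
        rw [Set.image_union, hm.union _ _ ((Set.disjoint_image_iff Subtype.val_injective).2 h),
          add_div]
      univ := by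
        rw [Set.image_univ, Subtype.range_coe, div_self hpos.ne']
      smul := fun l A => by
        rw [← hm.smul (φ l) (Subtype.val '' A), Set.image_image, Set.image_image]
        rfl }⟩
  exact x.2 fun l => congrArg Subtype.val (hx l)

/-- A free product of finitely many groups with property (F), except that one of them only has it
virtually, has virtually (F). The preimage `K` of a finite index subgroup `H` of that factor is
generated by `H` and finitely many conjugates of the other factors. -/
theorem hasVirtuallyF_coprodI {ι : Type*} [Finite ι] {G : ι → Type*} [∀ i, Group (G i)]
    (i₀ : ι) (hF : ∀ i, i ≠ i₀ → HasPropertyF (G i)) (hi₀ : HasVirtuallyF (G i₀)) :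
    HasVirtuallyF (CoprodI G) := by
  obtain ⟨H, hH, hHF⟩ := hi₀
  let K : Subgroup (CoprodI G) := H.comap (proj i₀)
  refine ⟨K, ⟨?_⟩, ?_⟩
  · rw [Subgroup.index_comap]
    exact (Subgroup.instFiniteIndex_subgroupOf H (proj i₀).range).index_ne_zero
  intro X _ _ ⟨m, hm⟩
  let φ₀ : H →* K := ((of (M := G)).comp H.subtype).codRestrict K fun h => by
    simp [K, Subgroup.mem_comap]
  let φ : ∀ p : {i // i ≠ i₀} × (G i₀ ⧸ H), G p.1 →* K := fun p =>
    ((MulAut.conj (of p.2.out⁻¹ : CoprodI G)).toMonoidHom.comp (of (M := G))).codRestrict K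
      fun g => by simp [K, Subgroup.mem_comap, proj_of_ne p.1.2]
  have hmean := hm.inter_eq_one (hHF.mean_fixed_eq_one hm φ₀)
    (hm.iInter_eq_one fun p => (hF p.1 p.1.2).mean_fixed_eq_one hm (φ p))
  obtain ⟨x, hx₀, hx⟩ := hm.nonempty_of_eq_one hmean
  rw [Set.mem_iInter] at hx
  let N : Subgroup (CoprodI G) := (MulAction.stabilizer K x).map K.subtype
  have hN₀ : ∀ h ∈ H, (of h : CoprodI G) ∈ N := fun h hh =>
    ⟨φ₀ ⟨h, hh⟩, hx₀ ⟨h, hh⟩, rfl⟩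
  have hN : ∀ i, i ≠ i₀ → ∀ (g : G i) (t : G i₀), of t * of g * (of t)⁻¹ ∈ N := by
    intro i hi g t
    let q : G i₀ ⧸ H := QuotientGroup.mk t⁻¹
    have h1 : of q.out⁻¹ * of g * (of q.out⁻¹)⁻¹ ∈ N := ⟨φ ⟨⟨i, hi⟩, q⟩ g, hx ⟨⟨i, hi⟩, q⟩ g, rfl⟩
    have h2 : t * q.out ∈ H := by
      have : t⁻¹⁻¹ * q.out ∈ H := QuotientGroup.eq.1 (QuotientGroup.out_eq' q).symm
      rwa [inv_inv] at this
    have h3 := N.mul_mem (N.mul_mem (hN₀ _ h2) h1) (N.inv_mem (hN₀ _ h2))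
    convert h3 using 1
    simp only [map_mul, map_inv]
    group
  -- The right cosets `N * of t` are permuted by every `g` as `t` is by `proj i₀ g`.
  have key : ∀ (g : CoprodI G) (t : G i₀), of t * g * (of (t * proj i₀ g))⁻¹ ∈ N := by
    intro g
    induction g using CoprodI.induction_on with
    | one => simp
    | of i g =>
      intro t
      by_cases hi : i = i₀
      · subst hi
        simp
      · rw [proj_of_ne hi, mul_one]
        exact hN i hi g t
    | mul g₁ g₂ h₁ h₂ =>
      intro t
      convert N.mul_mem (h₁ t) (h₂ (t * proj i₀ g₁)) using 1
      simp only [map_mul]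
      group
  refine ⟨x, fun k => ?_⟩
  have h1 := N.mul_mem (key k 1) (hN₀ _ k.2)
  obtain ⟨k', hk', h2⟩ : (k : CoprodI G) ∈ N := by simpa using h1
  obtain rfl : k' = k := Subtype.ext h2
  exact hk'

/-! ### Free products in the class `𝒜` -/

section

variable {ι : Type*} [Countable ι] {G : ι → Type*}
  [∀ i, Group (G i)] [∀ i, Countable (G i)] [∀ i, Infinite (G i)]

/-- The action of the factor `G i` is extended to the free product through the projection. Any other
factor acts trivially, so that the null set is invariant under it. -/
theorem memClassA_of_not_hasVirtuallyF [Nontrivial ι] (i : ι) (h : ¬ HasVirtuallyF (G i)) :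
    MemClassA (CoprodI G) := by
  obtain ⟨C, _, act, m, T, hm, hT, hmeet⟩ := exists_null_set_of_not_hasVirtuallyF h
  let act' : MulAction (CoprodI G) C := MulAction.compHom C (proj i)
  have hsmul : ∀ (w : CoprodI G) (c : C), w • c = proj i w • c := fun _ _ => rfl
  obtain ⟨a, ha⟩ := exists_ne i
  refine memClassA_of_null_set (hm.comap (proj i) hsmul) a T hT (fun g t ht => ?_) fun c => ?_
  · rwa [hsmul, proj_of_ne ha, one_smul]
  · obtain ⟨g, hg⟩ := hmeet c
    exact ⟨of g, by rwa [hsmul, proj_of_self]⟩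

/-- A free product of infinitely many groups acts, fibrewise through the projections, on the
disjoint union of infinitely many factors, so that each element fixes almost all of the units. -/
theorem memClassA_of_infinite [Infinite ι] : MemClassA (CoprodI G) := by
  let ν' : ℕ ↪ ι := Infinite.natEmbedding ι
  let ν : ℕ → ι := fun k => ν' (k + 1)
  have hν : Function.Injective ν := ν'.injective.comp (add_left_injective 1)
  have ha : ∀ k, ν' 0 ≠ ν k := fun k h => by simpa using ν'.injective h
  let act : ∀ k, MulAction (CoprodI G) (G (ν k)) := fun k => MulAction.compHom _ (proj (ν k))
  have hsmul : ∀ (w : CoprodI G) (k : ℕ) (x : G (ν k)),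
      w • (⟨k, x⟩ : Σ k, G (ν k)) = ⟨k, proj (ν k) w * x⟩ := fun _ _ _ => rfl
  have hfix : ∀ w : CoprodI G, ∀ᶠ k in atTop, proj (ν k) w = 1 := by
    intro w
    induction w using CoprodI.induction_on with
    | one => simp
    | of i g =>
      have : ∀ᶠ k in cofinite, ν k ≠ i := 
        hν.tendsto_cofinite (Set.finite_singleton i).compl_mem_cofinite
      rw [Nat.cofinite_eq_atTop] at this
      exact this.mono fun k hk => proj_of_ne hk.symm g
    | mul w₁ w₂ h₁ h₂ =>
      filter_upwards [h₁, h₂] with k h₁ h₂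
      rw [map_mul, h₁, h₂, one_mul]
  classical
  obtain ⟨m, hm, h0⟩ := exists_isInvariantMean_of_tendsto (G := CoprodI G)
    (fun k (A : Set (Σ k, G (ν k))) => if ⟨k, 1⟩ ∈ A then (1 : ℝ) else 0)
    (fun k A => by split_ifs <;> norm_num) (fun k A => by split_ifs <;> norm_num)
    (fun k A B h => by
      by_cases hA : ⟨k, 1⟩ ∈ A
      · simp [hA, h.notMem_of_mem_left hA]
      · simp [hA])
    (fun k => by simp)
    (fun g A => by
      refine tendsto_const_nhds.congr' ?_
      filter_upwards [hfix g] with k hk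
      have hg : g • (⟨k, 1⟩ : Σ k, G (ν k)) = ⟨k, 1⟩ := by rw [hsmul, hk, one_mul]
      have : (⟨k, 1⟩ : Σ k, G (ν k)) ∈ (fun x => g • x) '' A ↔ ⟨k, 1⟩ ∈ A := by
        conv_lhs => rw [← hg]
        exact (MulAction.injective g).mem_set_image
      simp only [this, sub_self])
  choose x hx using fun k => exists_ne (1 : G (ν k))
  refine memClassA_of_null_set hm (ν' 0) {z | z.2 = x z.1} (h0 _ ?_) ?_ ?_
  · refine tendsto_const_nhds.congr fun k => ?_
    simp [(hx k).symm]
  · rintro g ⟨k, y⟩ hy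
    rwa [hsmul, proj_of_ne (ha k), one_mul]
  · rintro ⟨k, y⟩
    exact ⟨of (x k * y⁻¹), by simp [hsmul]⟩

/-- If two factors have nontrivial finite transitive actions on `A` and `B`, the free product has
transitive actions on `A × B × ZMod n` for every `n`: one factor acts on `A`, the other one acts
on `B` and changes the third coordinate when it moves `β` to or from another point, above `α`. The
orbits of the former factor have at most as many points as `A`, so that one in each of these sets
is a null set as `n` grows. -/
theorem memClassA_of_finite_actions {p q : ι} (hpq : p ≠ q) {A B : Type*} [Finite A] [Finite B]
    [Nontrivial A] [Nontrivial B] [MulAction (G p) A] [MulAction (G q) B]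
    [MulAction.IsPretransitive (G p) A] [MulAction.IsPretransitive (G q) B] :
    MemClassA (CoprodI G) := by
  classical
  have : Nontrivial ι := ⟨p, q, hpq⟩
  obtain ⟨α, α', hα⟩ := exists_pair_ne A
  obtain ⟨β, β', hβ⟩ := exists_pair_ne B
  let f : ∀ k : ℕ, A → B → ZMod (k + 1) := fun k x y => if x = α ∧ y = β then 1 else 0
  let τ₁ : ∀ k : ℕ, G p →* Equiv.Perm (A × B × ZMod (k + 1)) := fun k => MonoidHom.mk'
    (fun g => (MulAction.toPerm g).prodCongr (Equiv.refl _))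
    (fun g h => by ext z <;> simp [mul_smul])
  -- This is the action on `B` conjugated by the translation of the third coordinate by `f k`.
  let τ₂ : ∀ k : ℕ, G q →* Equiv.Perm (A × B × ZMod (k + 1)) := fun k => MonoidHom.mk'
    (fun g =>
      { toFun := fun z => (z.1, g • z.2.1, z.2.2 - f k z.1 z.2.1 + f k z.1 (g • z.2.1))
        invFun := fun z => (z.1, g⁻¹ • z.2.1, z.2.2 - f k z.1 z.2.1 + f k z.1 (g⁻¹ • z.2.1))
        left_inv := fun z => by simp
        right_inv := fun z => by simp })
    (fun g h => by ext z <;> simp [mul_smul])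
  let P : ∀ k : ℕ, CoprodI G →* Equiv.Perm (A × B × ZMod (k + 1)) := fun k =>
    lift fun i => if i = p then ((τ₁ k).comp (proj p)).comp of else ((τ₂ k).comp (proj q)).comp of
  have hPp : ∀ k (g : G p) x y n, P k (of g) (x, y, n) = (g • x, y, n) := fun k g x y n => by
    simp [P, τ₁]
  have hPq : ∀ k (g : G q) x y n, P k (of g) (x, y, n) = (x, g • y, n - f k x y + f k x (g • y)) :=
    fun k g x y n => by simp [P, τ₂, hpq.symm]
  clear_value P
  let act : ∀ k : ℕ, MulAction (CoprodI G) (A × B × ZMod (k + 1)) := fun k =>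
    MulAction.compHom _ (P k)
  have hmove : ∀ k x x' y n, ∃ w, P k w (x, y, n) = (x', y, n) := by
    intro k x x' y n
    obtain ⟨g, rfl⟩ := MulAction.exists_smul_eq (G p) x x'
    exact ⟨of g, hPp k g x y n⟩
  have htrans : ∀ k (u v w : A × B × ZMod (k + 1)),
      (∃ g, P k g u = v) → (∃ g, P k g v = w) → ∃ g, P k g u = w := by
    rintro k u v w ⟨g, rfl⟩ ⟨h, rfl⟩
    exact ⟨h * g, by rw [map_mul, Equiv.Perm.mul_apply]⟩
  have hmove₂ : ∀ k x x' y y' n, ∃ w, P k w (x, y, n) = (x', y', n) := by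
    intro k x x' y y' n
    refine htrans k _ _ _ (hmove k x α' y n) (htrans k _ (α', y', n) _ ?_ (hmove k α' x' y' n))
    obtain ⟨g, rfl⟩ := MulAction.exists_smul_eq (G q) y y'
    exact ⟨of g, by simp [hPq, f, hα.symm]⟩
  have hshift : ∀ k n, ∃ w, P k w (α, β, n) = (α, β, n + 1) := by
    intro k n
    refine htrans k _ _ _ (hmove₂ k α α β β' n) ?_
    obtain ⟨g, hg⟩ := MulAction.exists_smul_eq (G q) β' β
    exact ⟨of g, by simp [hPq, hg, f, hβ.symm]⟩
  have hshifts : ∀ k n (j : ℕ), ∃ w, P k w (α, β, n) = (α, β, n + j) := by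
    intro k n j
    induction j with
    | zero => exact ⟨1, by simp⟩
    | succ j ih =>
      refine htrans k _ _ _ ih ?_
      simpa [add_assoc] using hshift k (n + j)
  have : Nonempty A := ⟨α⟩
  have : Nonempty B := ⟨β⟩
  obtain ⟨m, hm, hT⟩ := exists_isInvariantMean_sigma (G := CoprodI G)
    (fun k => A × B × ZMod (k + 1)) (fun k => {z | z.2 = (β, 0)}) (fun k => by
      have h1 : {z : A × B × ZMod (k + 1) | z.2 = (β, 0)} = (fun x => (x, β, 0)) '' Set.univ := by
        ext ⟨x, z⟩
        simp [eq_comm]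
      have h2 : 0 < Nat.card B := Nat.card_pos
      rw [h1, Set.ncard_image_of_injective _ (fun x y h => by simpa using h), Set.ncard_univ,
        Nat.card_prod, Nat.card_prod, Nat.card_zmod]
      nlinarith [Nat.zero_le (Nat.card A * (k + 1) * (Nat.card B - 1)),
        Nat.mul_le_mul_left (Nat.card A * (k + 1)) h2])
  refine memClassA_of_null_set hm p _ hT ?_ ?_
  · rintro g ⟨k, x, z⟩ (rfl : z = (β, 0))
    change (P k (of g) (x, β, 0)).2 = (β, 0)
    rw [hPp]
  · rintro ⟨k, x, y, n⟩
    obtain ⟨w, hw⟩ := htrans k _ _ _ (hmove₂ k x α y β n) (hshifts k n (-n).val)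
    refine ⟨w, ?_⟩
    change (P k w (x, y, n)).2 = (β, 0)
    rw [hw, ZMod.natCast_zmod_val, add_neg_cancel]

theorem HasVirtuallyF.exists_finiteIndex_ne_top {L : Type*} [Group L] (h : HasVirtuallyF L)
    (hF : ¬ HasPropertyF L) : ∃ H : Subgroup L, H.FiniteIndex ∧ H ≠ ⊤ := by
  obtain ⟨H, hH, hHF⟩ := h
  refine ⟨H, hH, ?_⟩
  rintro rfl
  refine hF fun X _ _ ⟨m, hm⟩ => ?_
  obtain ⟨x, hx⟩ := hHF X ⟨m, hm.comap (L := (⊤ : Subgroup L)) (fun h => h) fun _ _ => rfl⟩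
  exact ⟨x, fun g => hx ⟨g, trivial⟩⟩

theorem memClassA_of_not_hasPropertyF {p q : ι} (hpq : p ≠ q) (hp : ¬ HasPropertyF (G p))
    (hq : ¬ HasPropertyF (G q)) : MemClassA (CoprodI G) := by
  have : Nontrivial ι := ⟨p, q, hpq⟩
  by_cases hvp : HasVirtuallyF (G p)
  · by_cases hvq : HasVirtuallyF (G q)
    · obtain ⟨H, hH, hH'⟩ := hvp.exists_finiteIndex_ne_top hp
      obtain ⟨H₂, hH₂, hH₂'⟩ := hvq.exists_finiteIndex_ne_top hq
      have : Nontrivial (G p ⧸ H) := QuotientGroup.nontrivial_iff.2 hH'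
      have : Nontrivial (G q ⧸ H₂) := QuotientGroup.nontrivial_iff.2 hH₂'
      exact memClassA_of_finite_actions hpq (A := G p ⧸ H) (B := G q ⧸ H₂)
    · exact memClassA_of_not_hasVirtuallyF q hvq
  · exact memClassA_of_not_hasVirtuallyF p hvp

end

theorem corollary2 {ι : Type*} [Countable ι] [Nontrivial ι] (G : ι → Type*)
    [∀ i, Group (G i)] [∀ i, Countable (G i)] [∀ i, Infinite (G i)] :
    Xor (MemClassA (Monoid.CoprodI G)) (HasVirtuallyF (Monoid.CoprodI G)) ∧
    (HasVirtuallyF (Monoid.CoprodI G) ↔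
      Finite ι ∧ ∃ i₀ : ι, (∀ i, i ≠ i₀ → HasPropertyF (G i)) ∧ HasVirtuallyF (G i₀)) := by
  by_cases hcond :
      Finite ι ∧ ∃ i₀ : ι, (∀ i, i ≠ i₀ → HasPropertyF (G i)) ∧ HasVirtuallyF (G i₀)
  · obtain ⟨_, i₀, hF, hi₀⟩ := hcond
    have h := hasVirtuallyF_coprodI i₀ hF hi₀
    exact ⟨Or.inr ⟨h, h.not_memClassA⟩, fun _ => ⟨inferInstance, i₀, hF, hi₀⟩, fun _ => h⟩
  · have h : MemClassA (CoprodI G) := by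
      rcases finite_or_infinite ι with hι | hι
      · by_cases hV : ∀ i, HasVirtuallyF (G i)
        · by_cases hall : ∀ i, HasPropertyF (G i)
          · obtain ⟨i₀⟩ : Nonempty ι := inferInstance
            exact (hcond ⟨hι, i₀, fun i _ => hall i, hV i₀⟩).elim
          · obtain ⟨p, hp⟩ := not_forall.1 hall
            by_contra hA
            refine hcond ⟨hι, p, fun q hqp => ?_, hV p⟩
            by_contra hq
            exact hA (memClassA_of_not_hasPropertyF hqp hq hp)
        · obtain ⟨i, hi⟩ := not_forall.1 hV
          exact memClassA_of_not_hasVirtuallyF i hi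
      · exact memClassA_of_infinite
    exact ⟨Or.inl ⟨h, fun hv => hv.not_memClassA h⟩,
      fun hv => (hv.not_memClassA h).elim, fun hc => (hcond hc).elim⟩
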